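/- Let $\mathcal{G}=(\mathcal{V},\mathcal{E},W)$ be a finite strongly connected weighted digraph with nonnegative weighted adjacency matrix $W$ ($W_{ij}>0$ exactly when there is an arc from $i$ to $j$; every vertex is reachable from every other vertex). Let $d_i=\sum_{j}W_{ij}$ be the (out-)degree of $i$, let $d_{\mathcal{G}}=\sum_i d_i$ be the volume of $\mathcal{G}$, and consider the random walk on $\mathcal{G}$ that jumps from $i$ to $j$ with probability $P_{ij}=W_{ij}/d_i$. Let $\pi$ be its stationary distribution. For a vertex $i$ and a set $\mathcal{X}\subseteq\mathcal{V}$, let $P_{\mathrm{es}}(i,\mathcal{X})$ be the probability that the walk started at $i$ reaches some vertex of $\mathcal{X}$ before it returns to $i$. For nonempty $\mathcal{X}$ put $$\Omega(i,\mathcal{X})=\frac{1}{d_{\mathcal{G}}\,\pi_i\,P_{\mathrm{es}}(i,\mathcal{X})}\quad\text{if } i\notin\mathcal{X},\qquad \Omega(i,\mathcal{X})=0\quad\text{if } i\in\mathcal{X},$$ and define the resistance distance of the vertex group $\mathcal{X}$ as $\Omega(\mathcal{X})=\sum_{i\in\mathcal{V}}\Omega(i,\mathcal{X})$. Then $\Omega$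 is a monotone decreasing and supermodular function of the nonempty set $\mathcal{X}$: for all nonempty vertex sets $\mathcal{X}\subseteq\mathcal{Y}\subseteq\mathcal{V}$, $$\Omega(\mathcal{X})\ \ge\ \Omega(\mathcal{Y}),$$ and, for every vertex $i\in\mathcal{V}$ (in particular for every $i\notin\mathcal{Y}$), $$\Omega(\mathcal{X})-\Omega(\mathcal{X}\cup\{i\})\ \ge\ \Omega(\mathcal{Y})-\Omega(\mathcal{Y}\cup\{i\}).$$ -/

import Mathlib

open MeasureTheory ProbabilityTheory Finset

/-- A weighted digraph on the vertex set `V`: a nonnegative weighted adjacency matrix, where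
`weight i j > 0` exactly when there is an arc from `i` to `j`. -/
structure WeightedDigraph (V : Type*) where
  weight : Matrix V V ℝ
  weight_nonneg : ∀ i j, 0 ≤ weight i j

namespace WeightedDigraph

/-- There is an arc from `i` to `j`. -/
def Arc {V : Type*} (G : WeightedDigraph V) (i j : V) : Prop := 0 < G.weight i j

/-- Every vertex is reachable from every other vertex along arcs. -/
def StronglyConnected {V : Type*} (G : WeightedDigraph V) : Prop :=
  ∀ i j : V, Relation.ReflTransGen G.Arc i j

/-- The (out-)degree of a vertex. -/
noncomputable def degree {V : Type*} [Fintype V] (G : WeightedDigraph V) (i : V) : ℝ :=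
  ∑ j, G.weight i j

/-- The volume of the digraph, the sum of all degrees. -/
noncomputable def volume {V : Type*} [Fintype V] (G : WeightedDigraph V) : ℝ :=
  ∑ i, G.degree i

/-- The transition matrix `D⁻¹ W`, with `D` the diagonal matrix of degrees. -/
noncomputable def transition {V : Type*} [Fintype V] (G : WeightedDigraph V) : Matrix V V ℝ :=
  Matrix.of fun i j => G.weight i j / G.degree i

theorem transition_apply {V : Type*} [Fintype V] (G : WeightedDigraph V) (i j : V) :
    G.transition i j = G.weight i j / G.degree i := rfl

theorem degree_nonneg {V : Type*} [Fintype V] (G : WeightedDigraph V) (i : V) :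
    0 ≤ G.degree i := Finset.sum_nonneg fun j _ => G.weight_nonneg i j

theorem transition_nonneg {V : Type*} [Fintype V] (G : WeightedDigraph V) (i j : V) :
    0 ≤ G.transition i j := div_nonneg (G.weight_nonneg i j) (G.degree_nonneg i)

theorem sum_transition {V : Type*} [Fintype V] (G : WeightedDigraph V) (i : V)
    (h : G.degree i ≠ 0) : ∑ j, G.transition i j = 1 := by
  simp only [transition_apply, ← Finset.sum_div]
  exact div_self h

/-! ### The stationary distribution -/

/-- `π` is a probability vector on the vertices that is invariant under one step of the walk. -/
structure IsStationary {V : Type*} [Fintype V] (G : WeightedDigraph V) (π : V → ℝ) : Prop where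
  nonneg : ∀ i, 0 ≤ π i
  sum_eq_one : ∑ i, π i = 1
  invariant : Matrix.vecMul π G.transition = π

/-- A nonnegative invariant vector with a positive entry is positive everywhere. -/
theorem pos_of_invariant {V : Type*} [Fintype V] (G : WeightedDigraph V)
    (hG : G.StronglyConnected) (hd : ∀ i, 0 < G.degree i) {π : V → ℝ} (h0 : ∀ i, 0 ≤ π i)
    (hinv : Matrix.vecMul π G.transition = π) {i : V} (hi : 0 < π i) (j : V) : 0 < π j := by
  induction hG i j with
  | refl => exact hi
  | @tail b c _ hbc ih =>
    have h1 : π c = ∑ k, π k * G.transition k c := by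
      conv_lhs => rw [← hinv]
      rfl
    rw [h1]
    have hP : 0 < G.transition b c := div_pos hbc (hd b)
    exact (mul_pos ih hP).trans_le
      (Finset.single_le_sum (f := fun k => π k * G.transition k c)
        (fun k _ => mul_nonneg (h0 k) (G.transition_nonneg k c)) (Finset.mem_univ b))

theorem exists_isStationary {V : Type*} [Fintype V] [Nonempty V] (G : WeightedDigraph V)
    (hd : ∀ i, 0 < G.degree i) : ∃ π, G.IsStationary π := by
  classical
  have hdet : (1 - G.transition).det = 0 := by
    refine Matrix.exists_mulVec_eq_zero_iff.1 ⟨fun _ => 1, ?_, ?_⟩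
    · obtain ⟨i⟩ := ‹Nonempty V›
      exact fun h => one_ne_zero (congrFun h i)
    · ext i
      have h1 : Matrix.mulVec G.transition (fun _ => (1 : ℝ)) i = 1 := by
        simp [Matrix.mulVec, dotProduct, G.sum_transition i (hd i).ne']
      rw [Matrix.sub_mulVec, Matrix.one_mulVec, Pi.sub_apply, h1, sub_self, Pi.zero_apply]
  obtain ⟨v, hv0, hv⟩ := Matrix.exists_vecMul_eq_zero_iff.2 hdet
  rw [Matrix.vecMul_sub, Matrix.vecMul_one, sub_eq_zero] at hv
  have hle : ∀ j ∈ Finset.univ, |v j| ≤ ∑ i, |v i| * G.transition i j := fun j _ => by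
    have h1 : v j = ∑ k, v k * G.transition k j := congrFun hv j
    rw [h1]
    refine (Finset.abs_sum_le_sum_abs _ _).trans (le_of_eq ?_)
    refine Finset.sum_congr rfl fun i _ => ?_
    rw [abs_mul, abs_of_nonneg (G.transition_nonneg i j)]
  have hsum : ∑ j, |v j| = ∑ j, ∑ i, |v i| * G.transition i j := by
    rw [Finset.sum_comm]
    refine Finset.sum_congr rfl fun i _ => ?_
    rw [← Finset.mul_sum, G.sum_transition i (hd i).ne', mul_one]
  have heq := (Finset.sum_eq_sum_iff_of_le hle).1 hsum
  have hS : 0 < ∑ i, |v i| := by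
    obtain ⟨i, hi⟩ := Function.ne_iff.1 hv0
    exact (abs_pos.2 hi).trans_le
      (Finset.single_le_sum (f := fun i => |v i|) (fun _ _ => abs_nonneg _) (Finset.mem_univ i))
  refine ⟨fun i => |v i| / ∑ k, |v k|, fun i => by positivity, ?_, ?_⟩
  · rw [← Finset.sum_div, div_self hS.ne']
  · ext j
    show ∑ i, |v i| / (∑ k, |v k|) * G.transition i j = _
    rw [heq j (Finset.mem_univ j), Finset.sum_div]
    exact Finset.sum_congr rfl fun i _ => by ring

theorem IsStationary.unique {V : Type*} [Fintype V] {G : WeightedDigraph V}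
    (hG : G.StronglyConnected) (hd : ∀ i, 0 < G.degree i) {π ρ : V → ℝ}
    (hπ : G.IsStationary π) (hρ : G.IsStationary ρ) : ρ = π := by
  have hpos : ∀ i, 0 < π i := by
    obtain ⟨i, -, hi⟩ : ∃ i ∈ Finset.univ, 0 < π i := by
      by_contra! h
      have := Finset.sum_nonpos h
      rw [hπ.sum_eq_one] at this
      linarith
    exact G.pos_of_invariant hG hd hπ.nonneg hπ.invariant hi
  have hne : (Finset.univ : Finset V).Nonempty := by
    by_contra h
    have := hπ.sum_eq_one
    rw [Finset.not_nonempty_iff_eq_empty.1 h] at this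
    simp at this
  obtain ⟨m, -, hm⟩ := Finset.exists_min_image Finset.univ (fun i => ρ i / π i) hne
  set c := ρ m / π m with hc
  have hσ0 : ∀ i, 0 ≤ (ρ - c • π) i := fun i => by
    have := (le_div_iff₀ (hpos i)).1 (hm i (Finset.mem_univ i))
    simpa using this
  have hσ : Matrix.vecMul (ρ - c • π) G.transition = ρ - c • π := by
    rw [Matrix.sub_vecMul, Matrix.smul_vecMul, hπ.invariant, hρ.invariant]
  have hσm : (ρ - c • π) m = 0 := by
    have := (hpos m).ne'
    simp [hc, div_mul_cancel₀ _ this]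
  have hρc : ρ = c • π := by
    ext i
    by_contra hi
    have hi' : 0 < (ρ - c • π) i :=
      lt_of_le_of_ne (hσ0 i) fun h => hi (sub_eq_zero.1 (by simpa using h.symm))
    exact (G.pos_of_invariant hG hd hσ0 hσ hi' m).ne' hσm
  have hc1 : c = 1 := by
    have h1 := hρ.sum_eq_one
    rw [hρc] at h1
    simpa [← Finset.mul_sum, hπ.sum_eq_one] using h1
  rw [hρc, hc1, one_smul]

open Classical in
/-- The stationary distribution of the random walk. By `isStationary_stationary` and
`IsStationary.unique` it exists and is unique on every strongly connected digraph with positive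
degrees, in particular on every one with at least two vertices. The value `0` is used only if there
is no stationary distribution, as for a single vertex without a loop. -/
noncomputable def stationary {V : Type*} [Fintype V] (G : WeightedDigraph V) : V → ℝ :=
  if h : ∃ π, G.IsStationary π then h.choose else 0

theorem isStationary_stationary {V : Type*} [Fintype V] [Nonempty V] (G : WeightedDigraph V)
    (hd : ∀ i, 0 < G.degree i) : G.IsStationary G.stationary := by
  have h := G.exists_isStationary hd
  rw [stationary, dif_pos h]
  exact h.choose_spec

/-- On a strongly connected digraph with at least two vertices all degrees are positive. -/
theorem StronglyConnected.degree_pos {V : Type*} [Fintype V] [Nontrivial V]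
    {G : WeightedDigraph V} (hG : G.StronglyConnected) (i : V) : 0 < G.degree i := by
  obtain ⟨j, hj⟩ := exists_ne i
  rcases (hG i j).cases_head with h | ⟨k, hk, -⟩
  · exact absurd h.symm hj
  · exact lt_of_lt_of_le hk
      (Finset.single_le_sum (f := fun j => G.weight i j) (fun j _ => G.weight_nonneg i j)
        (Finset.mem_univ k))

/-! ### The random walk -/

open Classical in
/-- The law of one step of the random walk from `i`: it jumps to `j` with probability
`G.transition i j`. From a vertex of degree `0`, where there is no transition, it stays put. -/
noncomputable def stepLaw {V : Type*} [Fintype V] [MeasurableSpace V]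
    (G : WeightedDigraph V) (i : V) : Measure V :=
  if G.degree i = 0 then Measure.dirac i
  else ∑ j, ENNReal.ofReal (G.transition i j) • Measure.dirac j

theorem isProbabilityMeasure_stepLaw {V : Type*} [Fintype V] [MeasurableSpace V]
    (G : WeightedDigraph V) (i : V) : IsProbabilityMeasure (G.stepLaw i) := by
  unfold stepLaw
  split_ifs with h
  · infer_instance
  · constructor
    simp only [Measure.coe_finsetSum, Measure.coe_smul, Finset.sum_apply, Pi.smul_apply,
      measure_univ, smul_eq_mul, mul_one]
    rw [← ENNReal.ofReal_sum_of_nonneg fun j _ => G.transition_nonneg i j,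
      G.sum_transition i h, ENNReal.ofReal_one]

/-- One step of the walk from the last vertex of a trajectory known up to time `n`. -/
noncomputable def stepKernel {V : Type*} [Fintype V] [MeasurableSpace V]
    [MeasurableSingletonClass V] (G : WeightedDigraph V) (n : ℕ) :
    Kernel ((_ : Finset.Iic n) → V) V where
  toFun h := G.stepLaw (h ⟨n, Finset.mem_Iic.2 le_rfl⟩)
  measurable' := (measurable_of_countable G.stepLaw).comp (measurable_pi_apply _)

instance {V : Type*} [Fintype V] [MeasurableSpace V] [MeasurableSingletonClass V]
    (G : WeightedDigraph V) (n : ℕ) : IsMarkovKernel (G.stepKernel n) :=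
  ⟨fun _ => G.isProbabilityMeasure_stepLaw _⟩

/-- The law, on the space of trajectories `ℕ → V`, of the random walk started at `i`. -/
noncomputable def walkLaw {V : Type*} [Fintype V] [MeasurableSpace V]
    [MeasurableSingletonClass V] (G : WeightedDigraph V) (i : V) : Measure (ℕ → V) :=
  Kernel.traj (X := fun _ => V) G.stepKernel 0 fun _ => i

/-! ### Escape probability and resistance distance -/

/-- The probability that the random walk started at `i` reaches some vertex of `X` before it
returns to `i`. -/
noncomputable def escapeProb {V : Type*} [Fintype V] [MeasurableSpace V]
    [MeasurableSingletonClass V] (G : WeightedDigraph V) (i : V) (X : Finset V) : ℝ :=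
  (G.walkLaw i).real {ω | ∃ t, 1 ≤ t ∧ ω t ∈ X ∧ ∀ s, 1 ≤ s → s ≤ t → ω s ≠ i}

/-- The resistance distance between a vertex and a group of vertices: the reciprocal of
`volume * stationary i * escapeProb i X` for `i ∉ X`, and `0` for `i ∈ X`. -/
noncomputable def resistance {V : Type*} [Fintype V] [DecidableEq V] [MeasurableSpace V]
    [MeasurableSingletonClass V] (G : WeightedDigraph V) (i : V) (X : Finset V) : ℝ :=
  if i ∈ X then 0 else 1 / (G.volume * G.stationary i * G.escapeProb i X)

/-- The resistance distance of a group of vertices, the sum over all vertices of the resistance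
distance to the group. -/
noncomputable def groupResistance {V : Type*} [Fintype V] [DecidableEq V] [MeasurableSpace V]
    [MeasurableSingletonClass V] (G : WeightedDigraph V) (X : Finset V) : ℝ :=
  ∑ i, G.resistance i X

end WeightedDigraph

/-!
The mean number of visits to `i` that the walk from `i` pays before it enters `X` is the reciprocal
of the escape probability, so `resistance i X` is this mean divided by `volume * stationary i`.
Monotonicity and supermodularity in `X` then hold trajectory by trajectory: a larger `X` is entered
earlier, and the visits lost when `Z` is added to `X` are those before `X` but after `Z`, of which
there are fewer the larger `X` is.

The mean number of visits is the entry `(i, i)` of `(1 - B)⁻¹ = ∑ n, B ^ n`, where `B` is the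
transition matrix with the columns in `X` set to zero. The escape probability is a coordinate of
the solution of a linear system whose matrix arises from `B` by setting column `i` to zero as well,
and the reciprocity is linear algebra with these two matrices.
-/

section TransientMatrix

open scoped Matrix

variable {V : Type*} [Fintype V]

/-- A substochastic matrix, read as a walk that may die, such that from every state the walk can
reach a state in which it dies with positive probability. -/
structure IsTransient (B : Matrix V V ℝ) : Prop where
  nonneg : ∀ i j, 0 ≤ B i j
  sum_le_one : ∀ i, ∑ j, B i j ≤ 1
  exists_sum_lt_one : ∀ i, ∃ j, Relation.ReflTransGen (fun k l => 0 < B k l) i j ∧ ∑ k, B j k < 1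

namespace IsTransient

variable {B : Matrix V V ℝ}

theorem abs_le_sum_of_mulVec_eq_self (hB : IsTransient B) {f : V → ℝ} (hf : B *ᵥ f = f) (i : V) :
    |f i| ≤ ∑ j, B i j * |f j| := calc
  |f i| = |∑ j, B i j * f j| := congrArg abs (congrFun hf i).symm
  _ ≤ ∑ j, |B i j * f j| := abs_sum_le_sum_abs _ _
  _ = ∑ j, B i j * |f j| := by simp only [abs_mul, abs_of_nonneg (hB.nonneg i _)]

theorem abs_eq_of_reflTransGen (hB : IsTransient B) {f : V → ℝ} (hf : B *ᵥ f = f) {m : V}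
    (hm : ∀ i, |f i| ≤ |f m|) {j : V} (hj : Relation.ReflTransGen (fun k l => 0 < B k l) m j) :
    |f j| = |f m| := by
  induction hj with
  | refl => rfl
  | @tail b c _ hbc ih =>
    by_contra hne
    have hc : |f c| < |f m| := lt_of_le_of_ne (hm c) hne
    have hb : |f b| < |f m| := calc
      |f b| ≤ ∑ k, B b k * |f k| := hB.abs_le_sum_of_mulVec_eq_self hf b
      _ < ∑ k, B b k * |f m| := sum_lt_sum
          (fun k _ => mul_le_mul_of_nonneg_left (hm k) (hB.nonneg b k))
          ⟨c, mem_univ c, mul_lt_mul_of_pos_left hc hbc⟩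
      _ = (∑ k, B b k) * |f m| := (sum_mul ..).symm
      _ ≤ |f m| := mul_le_of_le_one_left (abs_nonneg _) (hB.sum_le_one b)
    exact hb.ne ih

theorem eq_zero_of_mulVec_eq_self (hB : IsTransient B) {f : V → ℝ} (hf : B *ᵥ f = f) : f = 0 := by
  by_contra hne
  obtain ⟨i, hi⟩ := Function.ne_iff.1 hne
  obtain ⟨m, -, hm⟩ := exists_max_image univ (fun j => |f j|) ⟨i, mem_univ i⟩
  replace hm : ∀ j, |f j| ≤ |f m| := fun j => hm j (mem_univ j)
  have hm0 : 0 < |f m| := (abs_pos.2 hi).trans_le (hm i)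
  obtain ⟨j, hmj, hj⟩ := hB.exists_sum_lt_one m
  have hjm : |f j| < |f m| := calc
    |f j| ≤ ∑ k, B j k * |f k| := hB.abs_le_sum_of_mulVec_eq_self hf j
    _ ≤ ∑ k, B j k * |f m| := sum_le_sum
        fun k _ => mul_le_mul_of_nonneg_left (hm k) (hB.nonneg j k)
    _ = (∑ k, B j k) * |f m| := (sum_mul ..).symm
    _ < |f m| := mul_lt_of_lt_one_left hm0 hj
  exact hjm.ne (hB.abs_eq_of_reflTransGen hf hm hmj)

variable [DecidableEq V]

theorem isUnit_one_sub (hB : IsTransient B) : IsUnit (1 - B) := by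
  refine Matrix.mulVec_injective_iff_isUnit.1
    ((injective_iff_map_eq_zero (1 - B).mulVecLin).2 fun f hf => hB.eq_zero_of_mulVec_eq_self ?_)
  rw [Matrix.mulVecLin_apply, Matrix.sub_mulVec, Matrix.one_mulVec, sub_eq_zero] at hf
  exact hf.symm

theorem pow_nonneg (hB : IsTransient B) (n : ℕ) (i j : V) : 0 ≤ (B ^ n) i j := by
  induction n generalizing j with
  | zero => rw [pow_zero, Matrix.one_apply]; positivity
  | succ n ih =>
    rw [pow_succ, Matrix.mul_apply]
    exact sum_nonneg fun k _ => mul_nonneg (ih k) (hB.nonneg k j)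

theorem sum_pow_le_one (hB : IsTransient B) (n : ℕ) (i : V) : ∑ j, (B ^ n) i j ≤ 1 := by
  induction n with
  | zero => simp [Matrix.one_apply]
  | succ n ih => calc
      ∑ j, (B ^ (n + 1)) i j = ∑ k, (B ^ n) i k * ∑ j, B k j := by
        simp only [pow_succ, Matrix.mul_apply, mul_sum]
        exact sum_comm
      _ ≤ ∑ k, (B ^ n) i k := sum_le_sum
          fun k _ => mul_le_of_le_one_right (hB.pow_nonneg n i k) (hB.sum_le_one k)
      _ ≤ 1 := ih

theorem pow_le_one (hB : IsTransient B) (n : ℕ) (i j : V) : (B ^ n) i j ≤ 1 :=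
  (single_le_sum (fun k _ => hB.pow_nonneg n i k) (mem_univ j)).trans (hB.sum_pow_le_one n i)

theorem abs_one_sub_pow_le_one (hB : IsTransient B) (n : ℕ) (i j : V) :
    |(1 - B ^ n) i j| ≤ 1 := by
  have h0 := hB.pow_nonneg n i j
  have h1 := hB.pow_le_one n i j
  rw [Matrix.sub_apply, Matrix.one_apply, abs_le]
  split_ifs <;> constructor <;> linarith

-- The partial sums are the matrices `(1 - B ^ n) * (1 - B)⁻¹`, which are bounded in `n`.
theorem summable_pow (hB : IsTransient B) : Summable fun n : ℕ => B ^ n := by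
  refine Pi.summable.2 fun i => Pi.summable.2 fun j => ?_
  refine summable_of_sum_range_le (c := ∑ k, |(1 - B)⁻¹ k j|) (hB.pow_nonneg · i j) fun n => ?_
  have hgeom : ∑ m ∈ range n, B ^ m = (1 - B ^ n) * (1 - B)⁻¹ := by
    rw [← geom_sum_mul_neg, Matrix.mul_nonsing_inv_cancel_right _ _
      ((Matrix.isUnit_iff_isUnit_det _).1 hB.isUnit_one_sub)]
  calc
    ∑ m ∈ range n, (B ^ m) i j = ∑ k, (1 - B ^ n) i k * (1 - B)⁻¹ k j := by
      rw [← Matrix.sum_apply, hgeom, Matrix.mul_apply]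
    _ ≤ ∑ k, |(1 - B ^ n) i k| * |(1 - B)⁻¹ k j| := sum_le_sum
        fun k _ => (le_abs_self _).trans (abs_mul _ _).le
    _ ≤ ∑ k, |(1 - B)⁻¹ k j| := sum_le_sum
        fun k _ => mul_le_of_le_one_left (abs_nonneg _) (hB.abs_one_sub_pow_le_one n i k)

theorem hasSum_pow (hB : IsTransient B) : HasSum (fun n : ℕ => B ^ n) (1 - B)⁻¹ := by
  rw [Matrix.inv_eq_left_inv hB.summable_pow.tsum_pow_mul_one_sub]
  exact hB.summable_pow.hasSum

end IsTransient

theorem updateCol_zero_mulVec [DecidableEq V] {W R : Type*} [NonUnitalNonAssocRing R]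
    (A : Matrix W V R) (j : V) (p : V → R) :
    A.updateCol j 0 *ᵥ p = A *ᵥ (p - Pi.single j (p j)) := by
  ext i
  refine sum_congr rfl fun k _ => ?_
  obtain rfl | hk := eq_or_ne k j <;> simp [*]

-- Both sides of `hp` are multiplied by `(1 - A)⁻¹`, and `(1 - A)⁻¹ * A = (1 - A)⁻¹ - 1`.
theorem mul_inv_one_sub_apply_self_of_updateCol [DecidableEq V] {R : Type*} [CommRing R]
    {A : Matrix V V R} (hA : IsUnit (1 - A)) {i : V} {p b : V → R}
    (hp : (1 - A.updateCol i 0) *ᵥ p = (1 - A) *ᵥ b) : p i * (1 - A)⁻¹ i i = b i := by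
  have hinv : (1 - A)⁻¹ * (1 - A) = 1 :=
    Matrix.nonsing_inv_mul _ ((Matrix.isUnit_iff_isUnit_det _).1 hA)
  have hinvA : (1 - A)⁻¹ * A = (1 - A)⁻¹ - 1 := by
    rw [mul_sub, mul_one, sub_eq_iff_eq_add'] at hinv
    exact eq_sub_of_add_eq hinv.symm
  have hsplit : (1 - A) *ᵥ p + A *ᵥ Pi.single i (p i) = (1 - A) *ᵥ b := by
    rw [← hp, Matrix.sub_mulVec, Matrix.sub_mulVec, updateCol_zero_mulVec, Matrix.mulVec_sub]
    abel
  have hb : p + ((1 - A)⁻¹ - 1) *ᵥ Pi.single i (p i) = b := calc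
    _ = (1 - A)⁻¹ *ᵥ ((1 - A) *ᵥ p + A *ᵥ Pi.single i (p i)) := by
      rw [Matrix.mulVec_add, Matrix.mulVec_mulVec, Matrix.mulVec_mulVec, hinv, hinvA,
        Matrix.one_mulVec]
    _ = b := by rw [hsplit, Matrix.mulVec_mulVec, hinv, Matrix.one_mulVec]
  rw [← hb]
  simp [mul_sub]

end TransientMatrix

section Taboo

open scoped Matrix

variable {V : Type*}

/-- The matrix `P` with the columns in `A` set to zero. The entries of its powers are the taboo
probabilities of the walk `P`: those of going from `i` to `j` in `n` steps without being in `A` at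
any of the times `1, …, n`. -/
noncomputable def taboo {R : Type*} [Zero R] (P : Matrix V V R) (A : Set V) : Matrix V V R :=
  Matrix.of fun i => Aᶜ.indicator (P i)

variable [DecidableEq V]

theorem taboo_insert {R : Type*} [Zero R] (P : Matrix V V R) (i : V) (A : Set V) :
    taboo P (insert i A) = (taboo P A).updateCol i 0 := by
  ext j k
  obtain rfl | hk := eq_or_ne k i
  · simp [taboo]
  · by_cases hkA : k ∈ A <;> simp [taboo, hk, hkA]

variable [Fintype V]

theorem isTransient_taboo {P : Matrix V V ℝ} (hP : P ∈ Matrix.rowStochastic ℝ V) {A : Set V}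
    (hA : ∀ i, ∃ a ∈ A, Relation.TransGen (fun k l => 0 < P k l) i a) :
    IsTransient (taboo P A) := by
  have hP0 : ∀ i j, 0 ≤ P i j := fun i j => Matrix.nonneg_of_mem_rowStochastic hP
  have hle : ∀ i j, taboo P A i j ≤ P i j := fun i => Set.indicator_le_self' fun j _ => hP0 i j
  have hlt : ∀ i, ∀ a ∈ A, 0 < P i a → ∑ j, taboo P A i j < 1 := fun i a ha hia => by
    rw [← Matrix.sum_row_of_mem_rowStochastic hP i]
    refine sum_lt_sum (fun j _ => hle i j) ⟨a, mem_univ a, ?_⟩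
    rwa [taboo, Matrix.of_apply, Set.indicator_of_notMem (Set.notMem_compl_iff.2 ha)]
  refine ⟨fun i => Set.indicator_nonneg fun j _ => hP0 i j, fun i =>
    (sum_le_sum fun j _ => hle i j).trans_eq (Matrix.sum_row_of_mem_rowStochastic hP i),
    fun i => ?_⟩
  obtain ⟨a, ha, hia⟩ := hA i
  induction hia using Relation.TransGen.head_induction_on with
  | @single j hja => exact ⟨j, .refl, hlt j a ha hja⟩
  | @head j k hjk _ ih =>
    by_cases hk : k ∈ A
    · exact ⟨j, .refl, hlt j k hk hjk⟩
    · obtain ⟨l, hkl, hl⟩ := ih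
      refine ⟨l, hkl.head ?_, hl⟩
      rwa [taboo, Matrix.of_apply, Set.indicator_of_mem hk]

end Taboo

section Trajectories

variable {V : Type*}

/-- The trajectories that are outside `A` at all times from `1` to `n`. Time `0` is exempt, so
that a walk started in `A` avoids `A` until it returns. -/
def avoiding (A : Set V) (n : ℕ) : Set (ℕ → V) :=
  {ω | ∀ s, 1 ≤ s → s ≤ n → ω s ∉ A}

/-- The trajectories that visit `i` at time `n` and have not been in `A` by then, time `0`
included. -/
def visitsBefore (i : V) (A : Set V) (n : ℕ) : Set (ℕ → V) :=
  {ω | ω n = i ∧ ∀ s ≤ n, ω s ∉ A}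

theorem avoiding_succ (A : Set V) (n : ℕ) :
    avoiding A (n + 1) = avoiding A n ∩ {ω | ω (n + 1) ∈ Aᶜ} := by
  ext ω
  refine ⟨fun h => ⟨fun s h1 hn => h s h1 (hn.trans n.le_succ), h _ n.succ_pos le_rfl⟩, ?_⟩
  rintro ⟨h, hn⟩ s h1 hs
  obtain hs | rfl := Nat.le_succ_iff.1 hs
  exacts [h s h1 hs, hn]

theorem avoiding_eq_preimage (A : Set V) (n : ℕ) :
    avoiding A n = Preorder.frestrictLe (π := fun _ => V) n ⁻¹'
      {x | ∀ s : Finset.Iic n, 1 ≤ (s : ℕ) → x s ∉ A} :=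
  Set.ext fun _ => ⟨fun h s h1 => h s h1 (mem_Iic.1 s.2), fun h s h1 hs => h ⟨s, mem_Iic.2 hs⟩ h1⟩

theorem pairwise_disjoint_avoiding_inter {A B : Set V} (hBA : B ⊆ A) :
    Pairwise (Function.onFun Disjoint fun t => avoiding A t ∩ {ω | ω (t + 1) ∈ B}) := by
  refine (pairwise_disjoint_on _).2 fun s t hst => Set.disjoint_left.2 ?_
  rintro ω ⟨-, hs⟩ ⟨ht, -⟩
  exact ht (s + 1) s.succ_pos hst (hBA hs)

theorem exists_reach_before_return_iff {i : V} {A : Set V} (hi : i ∉ A) (ω : ℕ → V) :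
    (∃ t, 1 ≤ t ∧ ω t ∈ A ∧ ∀ s, 1 ≤ s → s ≤ t → ω s ≠ i) ↔
      ∃ t, ω ∈ avoiding (insert i A) t ∧ ω (t + 1) ∈ A := by
  classical
  constructor
  · intro h
    obtain ⟨h1, hA, hne⟩ := Nat.find_spec h
    obtain ⟨t, ht⟩ := Nat.exists_eq_add_of_le' h1
    rw [ht] at hA hne
    refine ⟨t, fun s hs hst => ?_, hA⟩
    rintro (hsi | hsA)
    · exact hne s hs (by omega) hsi
    · exact Nat.find_min h (by omega : s < _) ⟨hs, hsA, fun r hr hrs => hne r hr (by omega)⟩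
  · rintro ⟨t, hav, hA⟩
    refine ⟨t + 1, t.succ_pos, hA, fun s hs hst hsi => ?_⟩
    obtain hst | rfl := Nat.le_succ_iff.1 hst
    exacts [hav s hs hst (.inl hsi), hi (hsi ▸ hA)]

theorem visitsBefore_of_mem {i : V} {A : Set V} (hi : i ∈ A) (n : ℕ) :
    visitsBefore i A n = ∅ :=
  Set.eq_empty_of_forall_notMem fun _ h => h.2 n le_rfl (h.1 ▸ hi)

theorem visitsBefore_anti (i : V) {A B : Set V} (hAB : A ⊆ B) (n : ℕ) :
    visitsBefore i B n ⊆ visitsBefore i A n :=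
  fun _ h => ⟨h.1, fun s hs hA => h.2 s hs (hAB hA)⟩

theorem visitsBefore_union (i : V) (A B : Set V) (n : ℕ) :
    visitsBefore i (A ∪ B) n = visitsBefore i A n ∩ visitsBefore i B n := by
  ext ω
  simp only [visitsBefore, Set.mem_union, Set.mem_inter_iff, Set.mem_ofPred_eq, not_or, forall_and]
  tauto

theorem visitsBefore_ae_eq [MeasurableSpace V] {μ : Measure (ℕ → V)} {i : V} {A : Set V}
    (hi : i ∉ A) (hμ : ∀ᵐ ω ∂μ, ω 0 = i) (n : ℕ) :
    visitsBefore i A n =ᵐ[μ] (avoiding A n ∩ {ω | ω n = i} : Set (ℕ → V)) := by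
  filter_upwards [hμ] with ω h0
  refine propext ⟨fun h => ⟨fun s _ hs => h.2 s hs, h.1⟩, fun h => ⟨h.2, fun s hs => ?_⟩⟩
  obtain rfl | h1 := s.eq_zero_or_pos
  exacts [h0 ▸ hi, h.1 s h1 hs]

variable [MeasurableSpace V] [MeasurableSingletonClass V] [Finite V]

theorem measurableSet_avoiding (A : Set V) (n : ℕ) : MeasurableSet (avoiding A n) := by
  rw [avoiding_eq_preimage]
  exact Preorder.measurable_frestrictLe n (Set.toFinite _).measurableSet

theorem measurableSet_visitsBefore (i : V) (A : Set V) (n : ℕ) :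
    MeasurableSet (visitsBefore i A n) := by
  have h : visitsBefore i A n = {ω | ω n = i} ∩ ⋂ s, ⋂ _ : s ≤ n, {ω | ω s ∈ Aᶜ} := by
    ext ω
    simp [visitsBefore]
  rw [h]
  exact (measurable_pi_apply n (measurableSet_singleton i)).inter <|
    MeasurableSet.iInter fun s : ℕ => MeasurableSet.iInter fun _ : s ≤ n =>
      measurable_pi_apply s Aᶜ.toFinite.measurableSet

/-- The two sides measure the visits before `Y`, respectively `X`, that come after `Z` has been
entered; there are fewer of these for the larger set. -/
theorem measureReal_visitsBefore_sub_union_anti (μ : Measure (ℕ → V)) [IsFiniteMeasure μ] (i : V)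
    {X Y : Set V} (hXY : X ⊆ Y) (Z : Set V) (n : ℕ) :
    μ.real (visitsBefore i Y n) - μ.real (visitsBefore i (Z ∪ Y) n) ≤
      μ.real (visitsBefore i X n) - μ.real (visitsBefore i (Z ∪ X) n) := by
  have hdiff : ∀ A : Set V, μ.real (visitsBefore i A n) - μ.real (visitsBefore i (Z ∪ A) n) =
      μ.real (visitsBefore i A n \ visitsBefore i Z n) := fun A => by
    rw [visitsBefore_union, Set.inter_comm, sub_eq_iff_eq_add',
      measureReal_inter_add_sdiff (measurableSet_visitsBefore i Z n)]
  rw [hdiff, hdiff]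
  exact measureReal_mono (Set.sdiff_subset_sdiff_left (visitsBefore_anti i hXY n))

end Trajectories

namespace WeightedDigraph

open scoped Matrix

section Stationary

variable {V : Type*} [Fintype V] (G : WeightedDigraph V)

theorem volume_mul_stationary_nonneg (i : V) : 0 ≤ G.volume * G.stationary i := by
  refine mul_nonneg (sum_nonneg fun j _ => G.degree_nonneg j) ?_
  rw [stationary]
  split_ifs with h
  exacts [h.choose_spec.nonneg i, le_rfl]

theorem transition_mem_rowStochastic [DecidableEq V] (hd : ∀ i, 0 < G.degree i) :
    G.transition ∈ Matrix.rowStochastic ℝ V :=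
  Matrix.mem_rowStochastic_iff_sum.2
    ⟨G.transition_nonneg, fun i => G.sum_transition i (hd i).ne'⟩

variable {G}

theorem StronglyConnected.transGen_transition [Nontrivial V] (hG : G.StronglyConnected) (i j : V) :
    Relation.TransGen (fun k l => 0 < G.transition k l) i j := by
  have hmono : ∀ k l, G.Arc k l → 0 < G.transition k l :=
    fun k l hkl => div_pos hkl (hG.degree_pos k)
  obtain ⟨k, hk⟩ := exists_ne i
  have hik : Relation.TransGen G.Arc i k :=
    (Relation.reflTransGen_iff_eq_or_transGen.1 (hG i k)).resolve_left hk
  exact Relation.TransGen.mono hmono _ _ (hik.trans_left (hG k j))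

theorem StronglyConnected.isTransient_taboo [Nontrivial V] (hG : G.StronglyConnected)
    {A : Set V} (hA : A.Nonempty) :
    IsTransient (taboo G.transition A) := by
  classical
  exact _root_.isTransient_taboo (G.transition_mem_rowStochastic hG.degree_pos)
    fun i => hA.imp fun a ha => ⟨ha, hG.transGen_transition i a⟩

end Stationary

section Walk

variable {V : Type*} [Fintype V] [MeasurableSpace V] [MeasurableSingletonClass V]
  (G : WeightedDigraph V)

instance isProbabilityMeasure_walkLaw (i : V) : IsProbabilityMeasure (G.walkLaw i) := by
  unfold walkLaw
  infer_instance

theorem walkLaw_ae_zero_eq (i : V) : ∀ᵐ ω ∂G.walkLaw i, ω 0 = i := by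
  have hmap := Kernel.traj_map_frestrictLe_apply (X := fun _ => V) (κ := G.stepKernel) 0 0
    fun _ => i
  rw [Kernel.partialTraj_self, Kernel.id_apply] at hmap
  have hstart : ∀ᵐ x ∂(G.walkLaw i).map (Preorder.frestrictLe (π := fun _ => V) 0),
      x ⟨0, mem_Iic.2 le_rfl⟩ = i := by
    rw [walkLaw, hmap, ae_dirac_iff (measurableSet_eq_fun (by fun_prop) measurable_const)]
  exact ae_of_ae_map (by fun_prop) hstart

theorem walkLaw_preimage_inter_succ (i : V) (n : ℕ) (S : Set (Finset.Iic n → V)) (B : Set V) :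
    G.walkLaw i (Preorder.frestrictLe n ⁻¹' S ∩ {ω | ω (n + 1) ∈ B}) =
      ∑ j, G.stepLaw j B * G.walkLaw i (Preorder.frestrictLe n ⁻¹' S ∩ {ω | ω n = j}) := by
  have hS : MeasurableSet S := S.toFinite.measurableSet
  have hB : MeasurableSet B := B.toFinite.measurableSet
  have hrestr : Measurable (Preorder.frestrictLe (π := fun _ => V) n) := by fun_prop
  have hlast : Measurable fun x : Finset.Iic n → V => x ⟨n, mem_Iic.2 le_rfl⟩ := by fun_prop
  have hprod := Kernel.partialTraj_compProd_eq_map_traj (X := fun _ => V) (κ := G.stepKernel)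
    (Nat.zero_le n) (x₀ := fun _ => i)
  have hmap := Kernel.traj_map_frestrictLe_apply (X := fun _ => V) (κ := G.stepKernel) 0 n
    fun _ => i
  calc
    _ = (G.walkLaw i).map (fun ω => (Preorder.frestrictLe n ω, ω (n + 1))) (S ×ˢ B) := by
      rw [Measure.map_apply (by fun_prop) (hS.prod hB)]
      rfl
    _ = ∫⁻ x in S, G.stepLaw (x ⟨n, mem_Iic.2 le_rfl⟩) B
          ∂(G.walkLaw i).map (Preorder.frestrictLe n) := by
      rw [walkLaw, ← hprod, Measure.compProd_apply_prod hS hB, hmap]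
      rfl
    _ = ∫⁻ j, G.stepLaw j B ∂(((G.walkLaw i).map (Preorder.frestrictLe n)).restrict S).map
          fun x => x ⟨n, mem_Iic.2 le_rfl⟩ :=
      (lintegral_map (f := fun j => G.stepLaw j B) (measurable_of_finite _) hlast).symm
    _ = _ := by
      rw [lintegral_fintype]
      refine sum_congr rfl fun j _ => ?_
      rw [Measure.map_apply hlast (measurableSet_singleton j),
        Measure.restrict_apply (hlast (measurableSet_singleton j)),
        Measure.map_apply hrestr ((hlast (measurableSet_singleton j)).inter hS), Set.preimage_inter,
        Set.inter_comm]
      rfl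

theorem walkLaw_real_avoiding_inter_succ (i : V) (A B : Set V) (n : ℕ) :
    (G.walkLaw i).real (avoiding A n ∩ {ω | ω (n + 1) ∈ B}) =
      ∑ j, (G.walkLaw i).real (avoiding A n ∩ {ω | ω n = j}) * (G.stepLaw j).real B := by
  have := G.isProbabilityMeasure_stepLaw
  rw [avoiding_eq_preimage, measureReal_def, walkLaw_preimage_inter_succ,
    ENNReal.toReal_sum fun j _ => ENNReal.mul_ne_top (measure_ne_top _ _) (measure_ne_top _ _)]
  simp only [ENNReal.toReal_mul, measureReal_def, mul_comm]

variable {G}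

theorem stepLaw_real {i : V} (hi : G.degree i ≠ 0) (B : Set V) :
    (G.stepLaw i).real B = ∑ j, B.indicator (G.transition i) j := by
  rw [measureReal_def, stepLaw, if_neg hi]
  simp only [Measure.coe_finsetSum, Measure.coe_smul, Finset.sum_apply, Pi.smul_apply, smul_eq_mul,
    Measure.dirac_apply' _ B.toFinite.measurableSet]
  rw [ENNReal.toReal_sum fun j _ => ENNReal.mul_ne_top ENNReal.ofReal_ne_top
    (by by_cases hj : j ∈ B <;> simp [hj])]
  refine sum_congr rfl fun j _ => ?_
  by_cases hj : j ∈ B <;> simp [hj, G.transition_nonneg]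

theorem stepLaw_real_eq_one_sub_taboo_mulVec [DecidableEq V] (hd : ∀ i, 0 < G.degree i)
    (A : Set V) : (fun i => (G.stepLaw i).real A) = (1 - taboo G.transition A) *ᵥ 1 := by
  ext i
  have := G.isProbabilityMeasure_stepLaw i
  rw [← compl_compl A, probReal_compl_eq_one_sub Aᶜ.toFinite.measurableSet,
    stepLaw_real (hd i).ne', compl_compl, Matrix.sub_mulVec, Matrix.one_mulVec]
  simp [Matrix.mulVec, dotProduct, taboo]

theorem walkLaw_real_avoiding_inter [DecidableEq V] (hd : ∀ i, 0 < G.degree i) (i k : V)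
    (A : Set V) (n : ℕ) :
    (G.walkLaw i).real (avoiding A n ∩ {ω | ω n = k}) = (taboo G.transition A ^ n) i k := by
  induction n generalizing k with
  | zero =>
    have hae : (avoiding A 0 ∩ {ω | ω 0 = k} : Set (ℕ → V)) =ᵐ[G.walkLaw i] {_ω | i = k} := by
      filter_upwards [G.walkLaw_ae_zero_eq i] with ω h0
      refine propext ⟨fun h => h0.symm.trans h.2, fun h => ⟨fun s h1 hs => ?_, h0.trans h⟩⟩
      omega
    rw [measureReal_congr hae, pow_zero, Matrix.one_apply]
    by_cases hik : i = k <;> simp [hik]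
  | succ n ih =>
    have hlast : avoiding A (n + 1) ∩ {ω | ω (n + 1) = k} =
        avoiding A n ∩ {ω | ω (n + 1) ∈ {k} ∩ Aᶜ} := by
      rw [avoiding_succ, Set.inter_assoc, Set.inter_comm _ {ω : ℕ → V | ω (n + 1) = k}]
      rfl
    rw [hlast, walkLaw_real_avoiding_inter_succ, pow_succ, Matrix.mul_apply]
    refine sum_congr rfl fun j _ => ?_
    rw [ih, stepLaw_real (hd j).ne', taboo, Matrix.of_apply, ← Set.indicator_indicator]
    simp [Set.indicator_singleton]

theorem hasSum_escapeProb {i : V} {X : Finset V} (hi : i ∉ X) :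
    HasSum (fun t => (G.walkLaw i).real (avoiding (insert i ↑X) t ∩ {ω | ω (t + 1) ∈ (X : Set V)}))
      (G.escapeProb i X) := by
  have hunion : {ω : ℕ → V | ∃ t, 1 ≤ t ∧ ω t ∈ X ∧ ∀ s, 1 ≤ s → s ≤ t → ω s ≠ i} =
      ⋃ t, avoiding (insert i ↑X) t ∩ {ω | ω (t + 1) ∈ (X : Set V)} := by
    ext ω
    rw [Set.mem_iUnion]
    exact exists_reach_before_return_iff (mem_coe.not.2 hi) ω
  rw [escapeProb, hunion]
  have hmeas : ∀ t, MeasurableSet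
      (avoiding (insert i ↑X) t ∩ {ω : ℕ → V | ω (t + 1) ∈ (X : Set V)}) :=
    fun t => (measurableSet_avoiding _ t).inter (measurable_pi_apply _ X.measurableSet)
  simpa only [Measure.toSignedMeasure_apply_measurable, hmeas, MeasurableSet.iUnion hmeas] using
    (G.walkLaw i).toSignedMeasure.m_iUnion hmeas
      (pairwise_disjoint_avoiding_inter (Set.subset_insert i (X : Set V)))

theorem escapeProb_eq_inv_taboo_mulVec [DecidableEq V] [Nontrivial V] (hG : G.StronglyConnected)
    {i : V} {X : Finset V} (hi : i ∉ X) :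
    G.escapeProb i X = ((1 - taboo G.transition (insert i ↑X))⁻¹ *ᵥ
      ((1 - taboo G.transition X) *ᵥ 1)) i := by
  have hpow := (hG.isTransient_taboo (Set.insert_nonempty i (X : Set V))).hasSum_pow
  have hvec := Pi.hasSum.1 (hpow.map
    (Matrix.mulVec.addMonoidHomLeft ((1 - taboo G.transition X) *ᵥ 1))
    (continuous_id.matrix_mulVec continuous_const)) i
  refine (hasSum_escapeProb hi).unique (hvec.congr_fun fun t => ?_)
  rw [walkLaw_real_avoiding_inter_succ]
  simp only [walkLaw_real_avoiding_inter hG.degree_pos]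
  rw [← stepLaw_real_eq_one_sub_taboo_mulVec hG.degree_pos]
  rfl

theorem escapeProb_mul_inv_taboo [DecidableEq V] [Nontrivial V] (hG : G.StronglyConnected)
    {i : V} {X : Finset V} (hX : X.Nonempty) (hi : i ∉ X) :
    G.escapeProb i X * (1 - taboo G.transition X)⁻¹ i i = 1 := by
  have hunit : ∀ A : Set V, A.Nonempty → IsUnit (1 - taboo G.transition A) :=
    fun A hA => (hG.isTransient_taboo hA).isUnit_one_sub
  rw [escapeProb_eq_inv_taboo_mulVec hG hi]
  refine mul_inv_one_sub_apply_self_of_updateCol (b := 1) (hunit X (coe_nonempty.2 hX)) ?_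
  rw [← taboo_insert, Matrix.mulVec_mulVec, Matrix.mul_nonsing_inv _
    ((Matrix.isUnit_iff_isUnit_det _).1 (hunit _ (Set.insert_nonempty i _))), Matrix.one_mulVec]

theorem hasSum_visitsBefore (hG : G.StronglyConnected) {i : V} {X : Finset V}
    (hX : X.Nonempty) (hi : i ∉ X) :
    HasSum (fun n => (G.walkLaw i).real (visitsBefore i X n)) (G.escapeProb i X)⁻¹ := by
  classical
  obtain ⟨x, hx⟩ := hX
  have : Nontrivial V := ⟨i, x, fun h => hi (h ▸ hx)⟩
  have hpow := (hG.isTransient_taboo (coe_nonempty.2 ⟨x, hx⟩)).hasSum_pow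
  rw [← eq_inv_of_mul_eq_one_right (escapeProb_mul_inv_taboo hG ⟨x, hx⟩ hi)]
  refine (Pi.hasSum.1 (Pi.hasSum.1 hpow i) i).congr_fun fun n => ?_
  rw [measureReal_congr (visitsBefore_ae_eq (mem_coe.not.2 hi) (G.walkLaw_ae_zero_eq i) n),
    walkLaw_real_avoiding_inter hG.degree_pos]

variable [DecidableEq V]

theorem hasSum_resistance (hG : G.StronglyConnected) (i : V) {X : Finset V} (hX : X.Nonempty) :
    HasSum (fun n => (G.volume * G.stationary i)⁻¹ * (G.walkLaw i).real (visitsBefore i X n))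
      (G.resistance i X) := by
  rw [resistance]
  split_ifs with hi
  · simp [visitsBefore_of_mem (mem_coe.2 hi)]
  · rw [one_div, mul_inv (G.volume * G.stationary i)]
    exact (hasSum_visitsBefore hG hX hi).mul_left _

theorem resistance_anti (hG : G.StronglyConnected) (i : V) {X Y : Finset V} (hX : X.Nonempty)
    (hXY : X ⊆ Y) : G.resistance i Y ≤ G.resistance i X := by
  refine hasSum_le (fun n => ?_) (hasSum_resistance hG i (hX.mono hXY)) (hasSum_resistance hG i hX)
  exact mul_le_mul_of_nonneg_left (measureReal_mono (visitsBefore_anti i (coe_subset.2 hXY) n))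
    (inv_nonneg.2 (G.volume_mul_stationary_nonneg i))

theorem resistance_sub_union_anti (hG : G.StronglyConnected) (i : V) {X Y : Finset V}
    (hX : X.Nonempty) (hXY : X ⊆ Y) (Z : Finset V) :
    G.resistance i Y - G.resistance i (Z ∪ Y) ≤ G.resistance i X - G.resistance i (Z ∪ X) := by
  have hY := hX.mono hXY
  refine hasSum_le (fun n => ?_)
    ((hasSum_resistance hG i hY).sub (hasSum_resistance hG i (hY.mono subset_union_right)))
    ((hasSum_resistance hG i hX).sub (hasSum_resistance hG i (hX.mono subset_union_right)))
  simp only [← mul_sub, coe_union]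
  exact mul_le_mul_of_nonneg_left
    (measureReal_visitsBefore_sub_union_anti _ i (coe_subset.2 hXY) Z n)
    (inv_nonneg.2 (G.volume_mul_stationary_nonneg i))

theorem groupResistance_anti (hG : G.StronglyConnected) {X Y : Finset V} (hX : X.Nonempty)
    (hXY : X ⊆ Y) : G.groupResistance Y ≤ G.groupResistance X :=
  sum_le_sum fun i _ => resistance_anti hG i hX hXY

theorem groupResistance_sub_union_anti (hG : G.StronglyConnected) {X Y : Finset V}
    (hX : X.Nonempty) (hXY : X ⊆ Y) (Z : Finset V) :
    G.groupResistance Y - G.groupResistance (Z ∪ Y) ≤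
      G.groupResistance X - G.groupResistance (Z ∪ X) := by
  simp only [groupResistance, ← sum_sub_distrib]
  exact sum_le_sum fun i _ => resistance_sub_union_anti hG i hX hXY Z

end Walk

end WeightedDigraph

theorem mainTheorem8 {V : Type*} [Fintype V] [DecidableEq V] [MeasurableSpace V]
    [MeasurableSingletonClass V] (G : WeightedDigraph V) (hG : G.StronglyConnected) :
    (∀ X Y : Finset V, X.Nonempty → X ⊆ Y → G.groupResistance X ≥ G.groupResistance Y) ∧
    (∀ X Y : Finset V, X.Nonempty → X ⊆ Y → ∀ i : V,
      G.groupResistance X - G.groupResistance (insert i X) ≥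
        G.groupResistance Y - G.groupResistance (insert i Y)) := by
  refine ⟨fun X Y hX hXY => WeightedDigraph.groupResistance_anti hG hX hXY,
    fun X Y hX hXY i => ?_⟩
  simp only [insert_eq i]
  exact WeightedDigraph.groupResistance_sub_union_anti hG hX hXY {i}
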